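/- Let $N,M,n\ge 1$ and let $T=(T_{x,y}^{a,b})$, $x,y\in\{1,\dots,N\}$, $a,b\in\{1,\dots,M\}$, be a real array (a Bell functional), with $\langle T,P\rangle=\sum_{x,y,a,b}T_{x,y}^{a,b}\,p(a,b|x,y)$ for $P=(p(a,b|x,y))\in\mathbb R^{N^2M^2}$. Let $\mathcal L^{in}$ be the set of all $P$ of the form $p(a,b|x,y)=\int_\Lambda q(a|x,\lambda)q'(b|y,\lambda)\,\mu(d\lambda)$ with $\mu$ a probability measure, $q,q'\ge 0$ measurable in $\lambda$, $\sum_a q(a|x,\lambda)\le 1$ and $\sum_b q'(b|y,\lambda)\le 1$. An incomplete POVM family on $\mathbb C^n$ is a family of positive semidefinite matrices $(E_a^x)$ in $M_n$ with $\sum_a E_a^x\le \mathbb 1$ for all $x$. Let $\mathcal Q_n^{in}$ be the set of all $P$ of the form $p(a,b|x,y)=\operatorname{tr}(\rho\,(E_a^x\otimes F_b^y))$ with $(E_a^x)$, $(F_b^y)$ incomplete POVM families on $\mathbb C^n$ and $\rho$ a density matrix on $\mathbb C^n\otimes\mathbb C^n$. The space $\ell_\infty^N(\ell_1^M)$ has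 norm $\max_x\sum_a|u_{x,a}|$, and its operator space structure is defined by $\|\sum_i A_i\otimes e_i\|_{M_k(\ell_\infty^N)}=\max_i\|A_i\|$, $M_k(\ell_1^M)=CB(\ell_\infty^M,M_k)$ and $M_k(\ell_\infty^N(\ell_1^M))=CB(\ell_1^N,M_k(\ell_1^M))$. Let $\|T\|$ be the norm of the real bilinear form $(u,v)\mapsto\sum T_{x,y}^{a,b}u_{x,a}v_{y,b}$ on $\ell_\infty^N(\ell_1^M)\times\ell_\infty^N(\ell_1^M)$, and let $\|T_n\|$ be the norm of the complex bilinear map $T_n=\mathbb 1_n\otimes\mathbb 1_n\otimes T: M_n(\ell_\infty^N(\ell_1^M))\times M_n(\ell_\infty^N(\ell_1^M))\to M_n\otimes M_n= M_{n^2}$. Then both norms are finite and: 1. $\displaystyle\sup_{P\in\mathcal L^{in}}|\langle T,P\rangle|\le\|T\|\le 4\sup_{P\in\mathcal L^{in}}|\langle T,P\rangle|$. 2. For positive semidefinite $E_a^x\in M_n$, one has $\|\sum_{x,a}E_a^x\otimes e_x\otimes e_a\|_{M_n(\ell_\infty^N(\ell_1^M))}\le 1$ if and only if $(E_a^x)$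 is an incomplete POVM family, i.e. $\sum_aE_a^x\le\mathbb 1$ for all $x$. 3. $\displaystyle\sup_{Q\in\mathcal Q_n^{in}}|\langle T,Q\rangle|\le\|T_n\|\le 16\sup_{Q\in\mathcal Q_n^{in}}|\langle T,Q\rangle|$. 4. If $T\ne 0$, then $\|T\|>0$, $\sup_{P\in\mathcal L^{in}}|\langle T,P\rangle|>0$ and $$\frac1{16}\frac{\|T_n\|}{\|T\|}\le\frac{\sup_{Q\in\mathcal Q_n^{in}}|\langle T,Q\rangle|}{\sup_{P\in\mathcal L^{in}}|\langle T,P\rangle|}\le 4\frac{\|T_n\|}{\|T\|}.$$ -/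

import Mathlib

open scoped ENNReal ComplexOrder Kronecker Matrix.Norms.L2Operator

noncomputable section

namespace BellViolation

/-! ### Bell functionals and (incomplete) distributions -/

/-- Arrays `(x, y, a, b) ↦ p(a, b | x, y)` with `N` inputs and `M` outputs per party. The same type
carries the coefficients `T x y a b` of a linear functional on such arrays. -/
abbrev BellArray (N M : ℕ) : Type := Fin N → Fin N → Fin M → Fin M → ℝ

/-- The value `⟨T, P⟩ = ∑ T_{x,y}^{a,b} p(a,b|x,y)`. -/
def pairing {N M : ℕ} (T P : BellArray N M) : ℝ :=
  ∑ x, ∑ y, ∑ a, ∑ b, T x y a b * P x y a b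

/-- `q(a|x) ≥ 0` and `∑ₐ q(a|x) ≤ 1` for every input `x`. -/
def IsIncompleteDistribution {N M : ℕ} (q : Fin N → Fin M → ℝ) : Prop :=
  (∀ x a, 0 ≤ q x a) ∧ ∀ x, ∑ a, q x a ≤ 1

/-- The set of incomplete local-hidden-variable distributions. -/
def localIn (N M : ℕ) : Set (BellArray N M) :=
  {P | ∃ (Λ : Type) (_ : MeasurableSpace Λ) (μ : MeasureTheory.Measure Λ)
      (q q' : Λ → Fin N → Fin M → ℝ),
      MeasureTheory.IsProbabilityMeasure μ ∧ Measurable q ∧ Measurable q' ∧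
      (∀ l, IsIncompleteDistribution (q l)) ∧ (∀ l, IsIncompleteDistribution (q' l)) ∧
      ∀ x y a b, P x y a b = ∫ l, q l x a * q' l y b ∂μ}

/-- For every input `x`, the matrices `E x a` are positive semidefinite and `∑ₐ E x a ≤ 1`. -/
def IsIncompletePOVM {N M n : ℕ} (E : Fin N → Fin M → Matrix (Fin n) (Fin n) ℂ) : Prop :=
  (∀ x a, (E x a).PosSemidef) ∧ ∀ x, (1 - ∑ a, E x a).PosSemidef

/-- The set of incomplete quantum distributions with local Hilbert spaces of dimension `n`. -/
def quantumIn (N M n : ℕ) : Set (BellArray N M) :=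
  {P | ∃ (E F : Fin N → Fin M → Matrix (Fin n) (Fin n) ℂ)
      (ρ : Matrix (Fin n × Fin n) (Fin n × Fin n) ℂ),
      IsIncompletePOVM E ∧ IsIncompletePOVM F ∧ ρ.PosSemidef ∧ ρ.trace = 1 ∧
      ∀ x y a b, (P x y a b : ℂ) = (ρ * (E x a ⊗ₖ F y b)).trace}

/-- `sup_{P ∈ S} |⟨T, P⟩|`, in `[0, ∞]`. -/
def supValue {N M : ℕ} (T : BellArray N M) (S : Set (BellArray N M)) : ℝ≥0∞ :=
  ⨆ P ∈ S, ‖pairing T P‖ₑ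

/-! ### Operator space structures

An operator space structure on `V` is recorded by its matrix norms `M_ι(V) → [0, ∞]`, for square
matrices indexed by a finite type `ι`. -/

/-- A family of `[0, ∞]`-valued functions, one on each space of square matrices over `V`. -/
abbrev MatrixNorms (V : Type) : Type 1 :=
  ∀ (ι : Type) [Fintype ι] [DecidableEq ι], Matrix ι ι V → ℝ≥0∞

/-- The operator space `ℂ`: on `M_ι` it is the operator norm of matrices acting on `ℓ₂`. -/
def scalarNorms : MatrixNorms ℂ := fun _ _ _ A => ‖A‖ₑ

/-- The operator space `M_m(V)`, through `M_ι(M_m(V)) = M_{ι × m}(V)`. -/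
def matrixSpaceNorms {V : Type} (NV : MatrixNorms V) (m : Type) [Fintype m] [DecidableEq m] :
    MatrixNorms (Matrix m m V) :=
  fun ι _ _ X => NV (ι × m) (Matrix.comp ι ι m m V X)

/-- The completely bounded norm `sup_k ‖1_k ⊗ u : M_k(V) → M_k(W)‖`. -/
def cbNorm {V W : Type} [AddCommGroup V] [Module ℂ V] [AddCommGroup W] [Module ℂ W]
    (NV : MatrixNorms V) (NW : MatrixNorms W) (u : V →ₗ[ℂ] W) : ℝ≥0∞ :=
  ⨆ (k : ℕ) (X : Matrix (Fin k) (Fin k) V) (_ : NV (Fin k) X ≤ 1), NW (Fin k) (X.map u)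

/-- `ℓ_∞^N`: `‖∑ᵢ Aᵢ ⊗ eᵢ‖ = maxᵢ ‖Aᵢ‖`. -/
def linftyNorms (N : ℕ) : MatrixNorms (Fin N → ℂ) :=
  fun ι _ _ X => ⨆ i, scalarNorms ι (X.map fun v => v i)

/-- `ℓ_1^M` as the operator space dual of `ℓ_∞^M`: `M_ι(ℓ_1^M) = CB(ℓ_∞^M, M_ι)`, where
`∑ₐ Aₐ ⊗ eₐ` is the map `b ↦ ∑ₐ bₐ Aₐ`. -/
def loneNorms (M : ℕ) : MatrixNorms (Fin M → ℂ) :=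
  fun ι _ _ X => cbNorm (linftyNorms M) (matrixSpaceNorms scalarNorms ι)
    (Fintype.linearCombination ℂ fun a => X.map fun v => v a)

/-- `ℓ_∞^N(ℓ_1^M)`, through `M_ι(ℓ_∞^N(ℓ_1^M)) = CB(ℓ_1^N, M_ι(ℓ_1^M))`, where
`∑ₓ eₓ ⊗ Xₓ` with `Xₓ ∈ M_ι(ℓ_1^M)` is the map `c ↦ ∑ₓ cₓ Xₓ`. -/
def linftyLoneNorms (N M : ℕ) : MatrixNorms (Fin N → Fin M → ℂ) :=
  fun ι _ _ X => cbNorm (loneNorms N) (matrixSpaceNorms (loneNorms M) ι)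
    (Fintype.linearCombination ℂ fun x => X.map fun v => v x)

/-- The element `∑ E x a ⊗ e_x ⊗ e_a` of `M_n(ℓ_∞^N(ℓ_1^M))`. -/
def assemble {N M n : ℕ} (E : Fin N → Fin M → Matrix (Fin n) (Fin n) ℂ) :
    Matrix (Fin n) (Fin n) (Fin N → Fin M → ℂ) :=
  Matrix.of fun i j x a => E x a i j

/-! ### The bilinear form of a Bell functional and its norms -/

/-- The bilinear form `(u, v) ↦ ∑ T_{x,y}^{a,b} u_{x,a} v_{y,b}` over `𝕜 = ℝ` or `ℂ`. -/
def bellForm (𝕜 : Type) [RCLike 𝕜] {N M : ℕ} (T : BellArray N M)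
    (u v : Fin N → Fin M → 𝕜) : 𝕜 :=
  ∑ x, ∑ y, ∑ a, ∑ b, (T x y a b : 𝕜) * u x a * v y b

/-- The norm of `T` as a real bilinear form on `ℓ_∞^N(ℓ_1^M) × ℓ_∞^N(ℓ_1^M)`. -/
def realNorm {N M : ℕ} (T : BellArray N M) : ℝ≥0∞ :=
  ⨆ (u : Fin N → PiLp 1 fun _ : Fin M => ℝ) (v : Fin N → PiLp 1 fun _ : Fin M => ℝ)
    (_ : ‖u‖ ≤ 1) (_ : ‖v‖ ≤ 1), ‖bellForm ℝ T (fun x a => u x a) (fun y b => v y b)‖ₑ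

/-- The amplification `T_n = 1_n ⊗ 1_n ⊗ T`, sending `(X, Y)` to the matrix in `M_n ⊗ M_n = M_{n²}`
with entries `T (X i i') (Y j j')`. -/
def amplification {N M : ℕ} (n : ℕ) (T : BellArray N M)
    (X Y : Matrix (Fin n) (Fin n) (Fin N → Fin M → ℂ)) :
    Matrix (Fin n × Fin n) (Fin n × Fin n) ℂ :=
  Matrix.kroneckerMap (bellForm ℂ T) X Y

/-- The norm of `T_n : M_n(ℓ_∞^N(ℓ_1^M)) × M_n(ℓ_∞^N(ℓ_1^M)) → M_{n²}` as a complex bilinear map. -/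
def amplificationNorm {N M : ℕ} (n : ℕ) (T : BellArray N M) : ℝ≥0∞ :=
  ⨆ (X : Matrix (Fin n) (Fin n) (Fin N → Fin M → ℂ))
    (Y : Matrix (Fin n) (Fin n) (Fin N → Fin M → ℂ))
    (_ : linftyLoneNorms N M (Fin n) X ≤ 1) (_ : linftyLoneNorms N M (Fin n) Y ≤ 1),
    ‖amplification n T X Y‖ₑ

end BellViolation

end

open scoped ENNReal ComplexOrder Kronecker Matrix Matrix.Norms.L2Operator

noncomputable section

namespace BellViolation

/-! ### Contractions and positive semidefinite matrices -/

section MatrixNorm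

open scoped MatrixOrder

variable {m n k : Type} [Fintype m] [Fintype n] [DecidableEq n] [Fintype k] [DecidableEq k]

/-! The classical and quantum values are suprema of the same bilinear expressions as the two norms,
restricted to positive elements of the unit balls. The lower bounds follow by averaging over the
hidden variable, respectively by pairing a Hermitian matrix with a state. The upper bounds require
writing an arbitrary element of the unit ball as a combination of positive ones.

Unwinding the operator space structure (`linftyLoneNorms_le_one_iff`), `X` lies in the unit ball of
`M_n(ℓ_∞^N(ℓ_1^M))` exactly when `‖∑ₐ Bₐ ⊗ X_{x,a}‖ ≤ 1` for each `x` and all contractions `Bₐ` of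
every size. If the coefficients are positive, this says `∑ₐ E_{x,a} ≤ 1`: necessity by taking `Bₐ =
1`, sufficiency by the dilation `Bₐ ⊗ Cₐ*Cₐ = (1 ⊗ Cₐ)*(Bₐ ⊗ 1)(1 ⊗ Cₐ)`.

A real vector splits into positive and negative parts, two per argument, whence the factor `4 = 2 ·
2`. In the matrix case, the real and imaginary parts of a completely contractive map `ℓ_∞ → M_n` are
each a difference of two positive families with sums at most `1`, a finite-dimensional Wittstock
decomposition (`exists_posSemidef_sub_of_isHermitian`). It comes from extending a positive
functional by the M. Riesz theorem and reading the positive families off its trace density. With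
four pieces per argument, weighted by powers of `i`, the factor is `16 = 4 · 4`. Dividing the two
comparisons gives the statement on ratios. -/

instance matrixCStarAlgebra : CStarAlgebra (Matrix n n ℂ) where

theorem norm_le_one_iff_posSemidef (A : Matrix m n ℂ) : ‖A‖ ≤ 1 ↔ (1 - Aᴴ * A).PosSemidef := by
  rw [← Matrix.le_iff, ← CStarAlgebra.norm_le_one_iff_of_nonneg (Aᴴ * A)
    (Matrix.nonneg_iff_posSemidef.2 (Matrix.posSemidef_conjTranspose_mul_self A)),
    Matrix.l2_opNorm_conjTranspose_mul_self, ← sq]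
  exact (sq_le_one_iff₀ (norm_nonneg A)).symm

theorem norm_le_one_iff_of_posSemidef {A : Matrix n n ℂ} (hA : A.PosSemidef) :
    ‖A‖ ≤ 1 ↔ (1 - A).PosSemidef := by
  rw [← Matrix.le_iff]
  exact CStarAlgebra.norm_le_one_iff_of_nonneg A (Matrix.nonneg_iff_posSemidef.2 hA)

theorem norm_submatrix_equiv_le_one_iff [DecidableEq m] (A : Matrix n n ℂ) (e : m ≃ n) :
    ‖A.submatrix e e‖ ≤ 1 ↔ ‖A‖ ≤ 1 := by
  rw [norm_le_one_iff_posSemidef, norm_le_one_iff_posSemidef, ← Matrix.posSemidef_submatrix_equiv e]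
  rw [Matrix.conjTranspose_submatrix, Matrix.submatrix_mul_equiv, Matrix.submatrix_sub]
  simp

theorem norm_kronecker_one_le_one {A : Matrix m n ℂ} (hA : ‖A‖ ≤ 1) :
    ‖A ⊗ₖ (1 : Matrix k k ℂ)‖ ≤ 1 := by
  rw [norm_le_one_iff_posSemidef] at hA ⊢
  have h := hA.kronecker (Matrix.PosSemidef.one (n := k) (R := ℂ))
  rw [Matrix.conjTranspose_kronecker, ← Matrix.mul_kronecker_mul, Matrix.conjTranspose_one,
    Matrix.one_mul]
  rwa [sub_eq_add_neg, Matrix.add_kronecker, Matrix.one_kronecker_one, ← neg_one_smul ℂ (Aᴴ * A),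
    Matrix.smul_kronecker, neg_one_smul, ← sub_eq_add_neg] at h

theorem norm_one_kronecker_le_one {A : Matrix m n ℂ} (hA : ‖A‖ ≤ 1) :
    ‖(1 : Matrix k k ℂ) ⊗ₖ A‖ ≤ 1 := by
  rw [norm_le_one_iff_posSemidef] at hA ⊢
  have h := (Matrix.PosSemidef.one (n := k) (R := ℂ)).kronecker hA
  rw [Matrix.conjTranspose_kronecker, ← Matrix.mul_kronecker_mul, Matrix.conjTranspose_one,
    Matrix.one_mul]
  rwa [sub_eq_add_neg, Matrix.kronecker_add, Matrix.one_kronecker_one, ← neg_one_smul ℂ (Aᴴ * A),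
    Matrix.kronecker_smul, neg_one_smul, ← sub_eq_add_neg] at h

theorem norm_kronecker_le_one [DecidableEq m] {A : Matrix m m ℂ} {B : Matrix n n ℂ} (hA : ‖A‖ ≤ 1)
    (hB : ‖B‖ ≤ 1) : ‖A ⊗ₖ B‖ ≤ 1 := by
  have h : A ⊗ₖ B = (A ⊗ₖ (1 : Matrix n n ℂ)) * ((1 : Matrix m m ℂ) ⊗ₖ B) := by
    rw [← Matrix.mul_kronecker_mul]; simp
  rw [h]
  exact (Matrix.l2_opNorm_mul _ _).trans
    (mul_le_one₀ (norm_kronecker_one_le_one hA) (norm_nonneg _) (norm_one_kronecker_le_one hB))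

theorem norm_le_iff_of_isHermitian {H : Matrix n n ℂ} (hH : H.IsHermitian) {c : ℝ} (hc : 0 ≤ c) :
    ‖H‖ ≤ c ↔ ((c : ℂ) • (1 : Matrix n n ℂ) - H).PosSemidef ∧
      ((c : ℂ) • (1 : Matrix n n ℂ) + H).PosSemidef := by
  have hsa : IsSelfAdjoint H := hH
  have hmap (r : ℝ) : algebraMap ℝ (Matrix n n ℂ) r = (r : ℂ) • 1 := by
    rw [Algebra.algebraMap_eq_smul_one]; ext i j; simp
  constructor
  · intro h
    have hle : algebraMap ℝ (Matrix n n ℂ) ‖H‖ ≤ algebraMap ℝ (Matrix n n ℂ) c :=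
      algebraMap_mono _ h
    have h1 := hsa.le_algebraMap_norm_self.trans hle
    have h2 := (neg_le_neg hle).trans hsa.neg_algebraMap_norm_le_self
    rw [hmap, Matrix.le_iff] at h1 h2
    refine ⟨h1, ?_⟩
    rwa [sub_neg_eq_add, add_comm] at h2
  · rintro ⟨h1, h2⟩
    rcases hc.eq_or_lt with rfl | hc
    · have h0 : H = 0 := le_antisymm (by simpa [Matrix.le_iff] using h1)
        (by simpa [Matrix.le_iff] using h2)
      simp [h0]
    have hstar : star ((c : ℂ)) = c := Complex.conj_ofReal c
    -- The identity used is `(c - H)(c + H)(c - H) + (c + H)(c - H)(c + H) = 2c(c² - H²)`; dividing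
    -- by `2c³` gives `1 - (H/c)² ≥ 0`.
    have e1 := h2.conjTranspose_mul_mul_same ((c : ℂ) • (1 : Matrix n n ℂ) - H)
    have e2 := h1.conjTranspose_mul_mul_same ((c : ℂ) • (1 : Matrix n n ℂ) + H)
    have hpos : (0 : ℂ) ≤ ((1 / (2 * c ^ 3) : ℝ) : ℂ) := by
      exact_mod_cast (by positivity : 0 ≤ 1 / (2 * c ^ 3))
    have e3 := (e1.add e2).smul hpos
    have h1 : ‖(c : ℂ)⁻¹ • H‖ ≤ 1 := by
      rw [norm_le_one_iff_posSemidef]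
      convert e3 using 1
      have hc' : (c : ℂ) ≠ 0 := by exact_mod_cast hc.ne'
      simp only [Matrix.conjTranspose_sub, Matrix.conjTranspose_add, Matrix.conjTranspose_smul,
        Matrix.conjTranspose_one, hH.eq, hstar, star_inv₀, Matrix.mul_add, Matrix.add_mul,
        Matrix.sub_mul, Matrix.mul_sub, Matrix.smul_mul, Matrix.mul_smul, Matrix.one_mul,
        Matrix.mul_one]
      push_cast
      match_scalars <;> field_simp <;> ring
    rw [norm_smul, norm_inv, Complex.norm_real, Real.norm_of_nonneg hc.le] at h1
    rwa [inv_mul_le_iff₀ hc, mul_one] at h1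

theorem trace_mul_nonneg {A B : Matrix n n ℂ} (hA : A.PosSemidef) (hB : B.PosSemidef) :
    0 ≤ (A * B).trace := by
  obtain ⟨C, rfl⟩ := CStarAlgebra.nonneg_iff_eq_star_mul_self.1
    (Matrix.nonneg_iff_posSemidef.2 hA)
  rw [Matrix.star_eq_conjTranspose, Matrix.mul_assoc, Matrix.trace_mul_comm]
  exact (hB.mul_mul_conjTranspose_same C).trace_nonneg

theorem abs_trace_mul_le {ρ H : Matrix n n ℂ} (hρ : ρ.PosSemidef) (htr : ρ.trace = 1)
    (hH : H.IsHermitian) : |(ρ * H).trace.re| ≤ ‖H‖ := by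
  obtain ⟨h1, h2⟩ := (norm_le_iff_of_isHermitian hH (norm_nonneg H)).1 le_rfl
  have e1 := (Complex.le_def.1 (trace_mul_nonneg hρ h1)).1
  have e2 := (Complex.le_def.1 (trace_mul_nonneg hρ h2)).1
  rw [abs_le]
  simp only [Matrix.mul_sub, Matrix.mul_add, Matrix.mul_smul, Matrix.trace_sub,
    Matrix.trace_add, Matrix.trace_smul, htr, smul_eq_mul, mul_one, Complex.sub_re, Complex.add_re,
    Complex.ofReal_re, Complex.zero_re] at e1 e2
  constructor <;> linarith

/-- The rank-one states `vv*/‖v‖²` already control the quadratic form of `H`, which determines the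
norm of a Hermitian matrix. -/
theorem norm_le_of_abs_trace_mul_le {H : Matrix n n ℂ} (hH : H.IsHermitian) {c : ℝ} (hc : 0 ≤ c)
    (h : ∀ ρ : Matrix n n ℂ, ρ.PosSemidef → ρ.trace = 1 → |(ρ * H).trace.re| ≤ c) : ‖H‖ ≤ c := by
  have key (v : n → ℂ) : |(star v ⬝ᵥ H *ᵥ v).re| ≤ c * (star v ⬝ᵥ v).re := by
    by_cases hv : v = 0
    · simp [hv]
    have hpos : 0 < star v ⬝ᵥ v := Matrix.dotProduct_star_self_pos_iff.2 hv
    obtain ⟨hre, him⟩ := Complex.lt_def.1 hpos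
    set r : ℝ := (star v ⬝ᵥ v).re with hr
    have hrr : star v ⬝ᵥ v = (r : ℂ) := Complex.ext rfl him.symm
    replace hre : 0 < r := hre
    have hri : (0 : ℂ) ≤ ((r⁻¹ : ℝ) : ℂ) := by exact_mod_cast (inv_pos.2 hre).le
    have hq := h (((r⁻¹ : ℝ) : ℂ) • Matrix.vecMulVec v (star v))
      ((Matrix.posSemidef_vecMulVec_self_star v).smul hri)
      (by
        rw [Matrix.trace_smul, Matrix.trace_vecMulVec, dotProduct_comm, hrr, smul_eq_mul]
        push_cast
        exact inv_mul_cancel₀ (by exact_mod_cast hre.ne'))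
    have htr : (Matrix.vecMulVec v (star v) * H).trace = star v ⬝ᵥ H *ᵥ v := by
      rw [Matrix.trace_mul_comm, Matrix.mul_vecMulVec, Matrix.trace_vecMulVec, dotProduct_comm]
    rw [Matrix.smul_mul, Matrix.trace_smul, htr, smul_eq_mul, Complex.re_ofReal_mul, abs_mul,
      abs_of_pos (inv_pos.2 hre), inv_mul_le_iff₀ hre] at hq
    linarith
  have him (v : n → ℂ) : (star v ⬝ᵥ H *ᵥ v).im = 0 := hH.im_star_dotProduct_mulVec_self v
  have him' (v : n → ℂ) : (star v ⬝ᵥ v).im = 0 :=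
    (Complex.le_def.1 (dotProduct_star_self_nonneg v)).2.symm
  have hone : ((c : ℂ) • (1 : Matrix n n ℂ)).IsHermitian := by
    simp [Matrix.IsHermitian, Matrix.conjTranspose_smul]
  rw [norm_le_iff_of_isHermitian hH hc]
  constructor
  · refine .of_dotProduct_mulVec_nonneg (hone.sub hH) fun v => ?_
    rw [Complex.le_def]
    have := abs_le.1 (key v)
    simp [Matrix.sub_mulVec, Matrix.smul_mulVec, dotProduct_sub, him, him']
    linarith
  · refine .of_dotProduct_mulVec_nonneg (hone.add hH) fun v => ?_
    rw [Complex.le_def]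
    have := abs_le.1 (key v)
    simp [Matrix.add_mulVec, Matrix.smul_mulVec, dotProduct_add, him, him']
    linarith

end MatrixNorm

/-! ### Completely bounded maps on `ℓ_∞` -/

section Conjugation

open scoped MatrixOrder

variable {α m n k : Type} [Fintype α] [DecidableEq α] [Fintype m] [DecidableEq m]
  [Fintype n] [DecidableEq n] [Fintype k] [DecidableEq k]

theorem exists_eq_conjTranspose_mul_self {A : Matrix n n ℂ} (hA : A.PosSemidef) :
    ∃ C : Matrix n n ℂ, A = Cᴴ * C :=
  CStarAlgebra.nonneg_iff_eq_star_mul_self.1 (Matrix.nonneg_iff_posSemidef.2 hA)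

theorem norm_blockDiagonal_le_one {D : α → Matrix n n ℂ} (hD : ∀ a, ‖D a‖ ≤ 1) :
    ‖Matrix.blockDiagonal D‖ ≤ 1 := by
  simp only [norm_le_one_iff_posSemidef] at hD ⊢
  choose C hC using fun a => exists_eq_conjTranspose_mul_self (hD a)
  have h : 1 - (Matrix.blockDiagonal D)ᴴ * Matrix.blockDiagonal D =
      (Matrix.blockDiagonal C)ᴴ * Matrix.blockDiagonal C := by
    rw [Matrix.blockDiagonal_conjTranspose, ← Matrix.blockDiagonal_mul,
      Matrix.blockDiagonal_conjTranspose, ← Matrix.blockDiagonal_mul,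
      ← Matrix.blockDiagonal_one, ← Matrix.blockDiagonal_sub]
    exact congrArg _ (funext hC)
  rw [h]
  exact Matrix.posSemidef_conjTranspose_mul_self _

/-- Stacking the `W a` into one column `V` turns the sum into `V* diag(D) V`, a product of three
contractions. -/
theorem norm_sum_conjugate_le_one {W : α → Matrix m n ℂ} {D : α → Matrix m m ℂ}
    (hW : (1 - ∑ a, (W a)ᴴ * W a).PosSemidef) (hD : ∀ a, ‖D a‖ ≤ 1) :
    ‖∑ a, (W a)ᴴ * D a * W a‖ ≤ 1 := by
  let V : Matrix (m × α) n ℂ := Matrix.of fun p q => W p.2 p.1 q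
  have hVV : Vᴴ * V = ∑ a, (W a)ᴴ * W a := by
    ext i j
    simp [V, Matrix.mul_apply, Matrix.sum_apply, Fintype.sum_prod_type_right]
  have hVDV : Vᴴ * (Matrix.blockDiagonal D * V) = ∑ a, (W a)ᴴ * D a * W a := by
    ext i j
    simp [V, Matrix.mul_apply, Matrix.sum_apply, Fintype.sum_prod_type_right, Matrix.mul_assoc,
      Matrix.blockDiagonal_apply]
  have hV : ‖V‖ ≤ 1 := by rwa [norm_le_one_iff_posSemidef, hVV]
  rw [← hVDV]
  refine (Matrix.l2_opNorm_mul _ _).trans (mul_le_one₀ ?_ (norm_nonneg _) ?_)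
  · rwa [Matrix.l2_opNorm_conjTranspose]
  · exact (Matrix.l2_opNorm_mul _ _).trans
      (mul_le_one₀ (norm_blockDiagonal_le_one hD) (norm_nonneg _) hV)

theorem norm_sum_kronecker_posSemidef_le_one {E : α → Matrix n n ℂ} (hE : ∀ a, (E a).PosSemidef)
    (hsum : (1 - ∑ a, E a).PosSemidef) {B : α → Matrix k k ℂ} (hB : ∀ a, ‖B a‖ ≤ 1) :
    ‖∑ a, B a ⊗ₖ E a‖ ≤ 1 := by
  choose C hC using fun a => exists_eq_conjTranspose_mul_self (hE a)
  have h1 (a : α) : B a ⊗ₖ E a = ((1 : Matrix k k ℂ) ⊗ₖ C a)ᴴ * (B a ⊗ₖ (1 : Matrix n n ℂ)) *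
      ((1 : Matrix k k ℂ) ⊗ₖ C a) := by
    rw [Matrix.conjTranspose_kronecker, ← Matrix.mul_kronecker_mul, ← Matrix.mul_kronecker_mul,
      hC a]
    simp
  have h2 : 1 - ∑ a, ((1 : Matrix k k ℂ) ⊗ₖ C a)ᴴ * ((1 : Matrix k k ℂ) ⊗ₖ C a) =
      (1 : Matrix k k ℂ) ⊗ₖ (1 - ∑ a, E a) := by
    simp only [Matrix.conjTranspose_kronecker, ← Matrix.mul_kronecker_mul, ← hC]
    ext ⟨i, i'⟩ ⟨j, j'⟩
    simp only [Matrix.sub_apply, Matrix.sum_apply, Matrix.kroneckerMap_apply, Matrix.one_apply,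
      Prod.mk.injEq, Matrix.conjTranspose_one, Matrix.mul_one]
    by_cases h : i = j <;> simp [h]
  simp only [h1]
  refine norm_sum_conjugate_le_one ?_ fun a => norm_kronecker_one_le_one (hB a)
  rw [h2]
  exact Matrix.PosSemidef.one.kronecker hsum

end Conjugation

/-! ### Decomposition of completely contractive maps on `ℓ_∞` into positive ones -/

section Decomposition

open scoped MatrixOrder

variable {α n : Type} [Fintype α] [Fintype n] [DecidableEq n]

/-- The real part of `1 + K` is positive because `(1 + K) + (1 + K)* = (1 - K*K) + (1 + K)*(1 + K)`.
-/
theorem re_dotProduct_add_nonneg {m : Type} [Fintype m] [DecidableEq m] {K : Matrix m m ℂ}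
    (hK : ‖K‖ ≤ 1) (v : m → ℂ) : 0 ≤ (star v ⬝ᵥ v).re + (star v ⬝ᵥ K *ᵥ v).re := by
  rw [norm_le_one_iff_posSemidef] at hK
  have h := (hK.add (Matrix.posSemidef_conjTranspose_mul_self (1 + K))).dotProduct_mulVec_nonneg v
  have e : 1 - Kᴴ * K + (1 + K)ᴴ * (1 + K) = (1 + K) + (1 + K)ᴴ := by
    simp [Matrix.add_mul, Matrix.mul_add]; abel
  have hstar : star v ⬝ᵥ (1 + K)ᴴ *ᵥ v = star (star v ⬝ᵥ (1 + K) *ᵥ v) := by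
    rw [Matrix.star_dotProduct, Matrix.star_mulVec, ← Matrix.dotProduct_mulVec,
      Matrix.conjTranspose_conjTranspose]
  rw [e, Matrix.add_mulVec, dotProduct_add, hstar] at h
  have h' := (Complex.le_def.1 h).1
  simp [Matrix.add_mulVec, dotProduct_add] at h'
  linarith

/-- Writing `L = C*C` and `b a = C* (B a) C`, the conditions `L ± b a ≥ 0` say that `B a` is a
Hermitian contraction. The inequality is then the norm bound for `∑ B aᵀ ⊗ X a`, evaluated at the
vector `vec C*`. Only test matrices of the same size `n` as `X a` occur. -/
theorem trace_add_sum_trace_nonneg_of_posDef {X b : α → Matrix n n ℂ} {L : Matrix n n ℂ}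
    (hX : ∀ B : α → Matrix n n ℂ, (∀ a, (B a).IsHermitian) → (∀ a, ‖B a‖ ≤ 1) →
      ‖∑ a, B a ⊗ₖ X a‖ ≤ 1)
    (hL : L.PosDef) (hb : ∀ a, (b a).IsHermitian) (hplus : ∀ a, (L + b a).PosSemidef)
    (hminus : ∀ a, (L - b a).PosSemidef) :
    0 ≤ L.trace.re + ∑ a, (b a * X a).trace.re := by
  obtain ⟨C, rfl⟩ := exists_eq_conjTranspose_mul_self hL.posSemidef
  have hdet : IsUnit C.det := by
    have := (Matrix.isUnit_iff_isUnit_det _).1 hL.isUnit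
    rw [Matrix.det_mul] at this
    exact isUnit_of_mul_isUnit_right this
  have hC1 : C * C⁻¹ = 1 := Matrix.mul_nonsing_inv _ hdet
  have hC2 : C⁻¹ * C = 1 := Matrix.nonsing_inv_mul _ hdet
  have hC3 : (C⁻¹)ᴴ * Cᴴ = 1 := by rw [← Matrix.conjTranspose_mul, hC1, Matrix.conjTranspose_one]
  have hC4 : Cᴴ * (C⁻¹)ᴴ = 1 := by rw [← Matrix.conjTranspose_mul, hC2, Matrix.conjTranspose_one]
  let B (a : α) : Matrix n n ℂ := (C⁻¹)ᴴ * b a * C⁻¹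
  have hbB (a : α) : b a = Cᴴ * B a * C := by
    simp only [B]
    calc b a = (Cᴴ * (C⁻¹)ᴴ) * b a * (C⁻¹ * C) := by simp [hC4, hC2]
      _ = _ := by simp only [Matrix.mul_assoc]
  have h1 : (C⁻¹)ᴴ * (Cᴴ * C) * C⁻¹ = 1 := by
    rw [← Matrix.mul_assoc, hC3, Matrix.one_mul, hC1]
  have hBH (a : α) : (B a)ᵀ.IsHermitian := by
    refine Matrix.IsHermitian.transpose ?_
    simp only [B, Matrix.IsHermitian, Matrix.conjTranspose_mul, Matrix.conjTranspose_conjTranspose,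
      (hb a).eq, Matrix.mul_assoc]
  have hBn (a : α) : ‖(B a)ᵀ‖ ≤ 1 := by
    rw [norm_le_iff_of_isHermitian (hBH a) zero_le_one]
    have p1 := ((hminus a).conjTranspose_mul_mul_same C⁻¹).transpose
    have p2 := ((hplus a).conjTranspose_mul_mul_same C⁻¹).transpose
    rw [Matrix.mul_sub, Matrix.sub_mul, h1] at p1
    rw [Matrix.mul_add, Matrix.add_mul, h1] at p2
    rw [Matrix.transpose_sub, Matrix.transpose_one] at p1
    rw [Matrix.transpose_add, Matrix.transpose_one] at p2
    rw [Complex.ofReal_one, one_smul]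
    exact ⟨p1, p2⟩
  -- `(Bᵀ ⊗ X) vec C* = vec (X C* B)`, so the transpose makes the quadratic form equal to `tr (C* B
  -- C X) = tr (b X)`, while `‖vec C*‖² = tr L`.
  have key := re_dotProduct_add_nonneg (hX (fun a => (B a)ᵀ) hBH hBn)
    (Matrix.vec Cᴴ)
  rw [Matrix.star_vec_dotProduct_vec, Matrix.conjTranspose_conjTranspose, Matrix.trace_mul_comm,
    Matrix.sum_mulVec, dotProduct_sum, Complex.re_sum] at key
  convert key using 3 with a
  rw [Matrix.kronecker_mulVec_vec, Matrix.star_vec_dotProduct_vec, hbB a, Matrix.transpose_transpose,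
    Matrix.conjTranspose_conjTranspose, Matrix.trace_mul_comm, ← Matrix.mul_assoc,
    Matrix.trace_mul_comm]
  simp only [Matrix.mul_assoc]

/-- The invertible case applies to `L + ε`; then `ε` tends to `0`. -/
theorem trace_add_sum_trace_nonneg {X b : α → Matrix n n ℂ} {L : Matrix n n ℂ}
    (hX : ∀ B : α → Matrix n n ℂ, (∀ a, (B a).IsHermitian) → (∀ a, ‖B a‖ ≤ 1) →
      ‖∑ a, B a ⊗ₖ X a‖ ≤ 1)
    (hL : L.PosSemidef) (hb : ∀ a, (b a).IsHermitian) (hplus : ∀ a, (L + b a).PosSemidef)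
    (hminus : ∀ a, (L - b a).PosSemidef) :
    0 ≤ L.trace.re + ∑ a, (b a * X a).trace.re := by
  have key (ε : ℝ) (hε : 0 < ε) :
      0 ≤ L.trace.re + ε * Fintype.card n + ∑ a, (b a * X a).trace.re := by
    have hε' : (0 : ℂ) < (ε : ℂ) := by exact_mod_cast hε
    have hI : ((ε : ℂ) • (1 : Matrix n n ℂ)).PosDef := Matrix.PosDef.one.smul hε'
    have h := trace_add_sum_trace_nonneg_of_posDef hX (Matrix.PosDef.posSemidef_add hL hI) hb
      (fun a => by
        rw [add_right_comm]; exact (hplus a).add hI.posSemidef)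
      (fun a => by
        rw [add_sub_right_comm]; exact (hminus a).add hI.posSemidef)
    simpa [Matrix.trace_add, Matrix.trace_smul] using h
  refine le_of_forall_pos_le_add fun δ hδ => ?_
  have hpos : (0 : ℝ) < Fintype.card n + 1 := by positivity
  have h := key (δ / (Fintype.card n + 1)) (by positivity)
  have h2 : δ / (Fintype.card n + 1) * Fintype.card n ≤ δ := by
    rw [div_mul_eq_mul_div, div_le_iff₀ hpos]
    nlinarith
  linarith

/-- The cone of families of matrices with positive semidefinite real part. -/
def accretiveCone (β n : Type) [Fintype n] : PointedCone ℝ (β → Matrix n n ℂ) where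
  carrier := {H | ∀ i v, 0 ≤ (star v ⬝ᵥ H i *ᵥ v).re}
  add_mem' := fun {H K} hH hK i v => by
    simpa [Matrix.add_mulVec, dotProduct_add] using add_nonneg (hH i v) (hK i v)
  zero_mem' := fun i v => by simp
  smul_mem' := fun c H hH i v => by
    have : (star v ⬝ᵥ (c • H) i *ᵥ v).re = c * (star v ⬝ᵥ H i *ᵥ v).re := by
      change (star v ⬝ᵥ ((c : ℝ) • H i) *ᵥ v).re = _
      rw [Matrix.smul_mulVec, dotProduct_smul, Complex.smul_re, smul_eq_mul]
    rw [this]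
    exact mul_nonneg c.2 (hH i v)

/-- A real linear functional that is nonnegative on matrices with positive semidefinite real part
is represented, through the trace, by a positive semidefinite matrix. -/
theorem exists_posSemidef_trace_eq (h : Matrix n n ℂ →ₗ[ℝ] ℝ)
    (hpos : ∀ Y : Matrix n n ℂ, (∀ v, 0 ≤ (star v ⬝ᵥ Y *ᵥ v).re) → 0 ≤ h Y) :
    ∃ G : Matrix n n ℂ, G.PosSemidef ∧ ∀ Y, h Y = (G * Y).trace.re := by
  have hquad (Y : Matrix n n ℂ) (v : n → ℂ) : star v ⬝ᵥ Yᴴ *ᵥ v = star (star v ⬝ᵥ Y *ᵥ v) := by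
    rw [Matrix.star_dotProduct, Matrix.star_mulVec, ← Matrix.dotProduct_mulVec,
      Matrix.conjTranspose_conjTranspose]
  have hadj (Y : Matrix n n ℂ) : h Yᴴ = h Y := by
    have h1 := hpos (Y - Yᴴ) fun v => by simp [Matrix.sub_mulVec, dotProduct_sub, hquad]
    have h2 := hpos (Yᴴ - Y) fun v => by simp [Matrix.sub_mulVec, dotProduct_sub, hquad]
    rw [map_sub] at h1 h2
    linarith
  -- The complex-linear functional with real part `h`; its values on matrix units are the entries of
  -- `G`.
  let g (Y : Matrix n n ℂ) : ℂ := ⟨h Y, -h (Complex.I • Y)⟩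
  have hgadd (Y Z : Matrix n n ℂ) : g (Y + Z) = g Y + g Z := by
    apply Complex.ext <;> simp [g]; ring
  have hgsmul (c : ℂ) (Y : Matrix n n ℂ) : g (c • Y) = c * g Y := by
    have e1 : c • Y = c.re • Y + c.im • (Complex.I • Y) := by
      ext i j
      apply Complex.ext <;> simp
      ring
    have e2 : Complex.I • c • Y = c.re • (Complex.I • Y) - c.im • Y := by
      ext i j
      apply Complex.ext <;> simp
      ring
    apply Complex.ext
    · simp only [g, e1]; simp [Complex.mul_re]
    · simp only [g, e2]; simp [Complex.mul_im]; ring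
  let gL : Matrix n n ℂ →ₗ[ℂ] ℂ := { toFun := g, map_add' := hgadd, map_smul' := hgsmul }
  have hgadj (Y : Matrix n n ℂ) : g Yᴴ = star (g Y) := by
    have e : Complex.I • Yᴴ = (-(Complex.I • Y))ᴴ := by simp [Matrix.conjTranspose_smul]
    apply Complex.ext
    · simp [g, hadj]
    · change -h (Complex.I • Yᴴ) = -(-h (Complex.I • Y))
      rw [e, hadj, map_neg]
  let G : Matrix n n ℂ := Matrix.of fun p q => g (Matrix.single q p 1)
  have hG (Y : Matrix n n ℂ) : g Y = (G * Y).trace := by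
    have e : gL Y = gL (∑ i, ∑ j, Matrix.single i j (Y i j)) :=
      congrArg gL (Matrix.matrix_eq_sum_single Y)
    change gL Y = _
    rw [e]
    simp only [map_sum, Matrix.trace, Matrix.diag_apply, Matrix.mul_apply]
    rw [Finset.sum_comm]
    refine Finset.sum_congr rfl fun j _ => Finset.sum_congr rfl fun i _ => ?_
    have e' : Matrix.single i j (Y i j) = Y i j • Matrix.single i j (1 : ℂ) := by simp
    rw [e', map_smul, smul_eq_mul, mul_comm]
    rfl
  refine ⟨G, .of_dotProduct_mulVec_nonneg ?_ fun v => ?_, fun Y => by rw [← hG]⟩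
  · ext p q
    rw [Matrix.conjTranspose_apply]
    change star (g _) = g _
    rw [← hgadj]
    simp
  · have e : star v ⬝ᵥ G *ᵥ v = g (Matrix.vecMulVec v (star v)) := by
      rw [hG, Matrix.mul_vecMulVec, Matrix.trace_vecMulVec, dotProduct_comm]
    have hP := Matrix.posSemidef_vecMulVec_self_star v
    have him := hgadj (Matrix.vecMulVec v (star v))
    rw [hP.isHermitian.eq] at him
    rw [e, Complex.le_def]
    refine ⟨hpos _ fun w => (Complex.le_def.1 (hP.dotProduct_mulVec_nonneg w)).1, ?_⟩
    have := congrArg Complex.im him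
    simp at this
    simp
    linarith

theorem eq_of_forall_re_trace_mul_eq {G K : Matrix n n ℂ}
    (h : ∀ Y, (G * Y).trace.re = (K * Y).trace.re) : G = K := by
  have h1 := h (G - K)ᴴ
  have h2 : ((G - K) * (G - K)ᴴ).trace.re = 0 := by
    rw [Matrix.sub_mul, Matrix.trace_sub, Complex.sub_re, h1, sub_self]
  have h3 : ((G - K) * (G - K)ᴴ).trace = 0 :=
    Complex.ext h2 (Complex.le_def.1
      (Matrix.posSemidef_self_mul_conjTranspose (G - K)).trace_nonneg).2.symm
  exact sub_eq_zero.1 (Matrix.trace_mul_conjTranspose_self_eq_zero_iff.1 h3)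

/-- The identity is an order unit for the accretive cone, which supplies the cofinality condition of
the Riesz extension theorem. -/
theorem exists_smul_one_add_accretive (Y : Matrix n n ℂ) :
    ∃ t : ℝ, ∀ s ≥ t, ∀ v, 0 ≤ (star v ⬝ᵥ ((s : ℂ) • (1 : Matrix n n ℂ) + Y) *ᵥ v).re := by
  refine ⟨‖Y‖ + 1, fun s hs v => ?_⟩
  have hpos : 0 < s := by linarith [norm_nonneg Y]
  have hn : ‖(s : ℂ)⁻¹ • Y‖ ≤ 1 := by
    rw [norm_smul, norm_inv, Complex.norm_real, Real.norm_of_nonneg hpos.le,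
      inv_mul_le_iff₀ hpos]
    linarith
  have h := re_dotProduct_add_nonneg hn v
  have e : ((s : ℂ) • (1 : Matrix n n ℂ) + Y) = (s : ℂ) • (1 + (s : ℂ)⁻¹ • Y) := by
    rw [smul_add, smul_smul, mul_inv_cancel₀ (by exact_mod_cast hpos.ne'), one_smul]
  rw [e, Matrix.smul_mulVec, dotProduct_smul, smul_eq_mul, Complex.re_ofReal_mul,
    Matrix.add_mulVec, dotProduct_add, Matrix.one_mulVec, Complex.add_re]
  exact mul_nonneg hpos.le h

theorem posSemidef_half_add_conjTranspose {Y : Matrix n n ℂ}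
    (hY : ∀ v, 0 ≤ (star v ⬝ᵥ Y *ᵥ v).re) : ((1 / 2 : ℂ) • (Y + Yᴴ)).PosSemidef := by
  refine .of_dotProduct_mulVec_nonneg ?_ fun v => ?_
  · simp [Matrix.IsHermitian, Matrix.conjTranspose_smul, Matrix.conjTranspose_add, add_comm]
  · have hstar : star v ⬝ᵥ Yᴴ *ᵥ v = star (star v ⬝ᵥ Y *ᵥ v) := by
      rw [Matrix.star_dotProduct, Matrix.star_mulVec, ← Matrix.dotProduct_mulVec,
        Matrix.conjTranspose_conjTranspose]
    rw [Matrix.smul_mulVec, Matrix.add_mulVec, dotProduct_smul, dotProduct_add, hstar,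
      Complex.le_def]
    have := hY v
    constructor <;> simp
    linarith

/-- A Hermitian family that is completely contractive, as a map on `ℓ_∞`, is a difference of two
positive families whose total sum is `1`. -/
theorem exists_posSemidef_sub_of_isHermitian [Nonempty α] {X : α → Matrix n n ℂ}
    (hXH : ∀ a, (X a).IsHermitian)
    (hX : ∀ B : α → Matrix n n ℂ, (∀ a, (B a).IsHermitian) → (∀ a, ‖B a‖ ≤ 1) →
      ‖∑ a, B a ⊗ₖ X a‖ ≤ 1) :
    ∃ P Q : α → Matrix n n ℂ, (∀ a, (P a).PosSemidef) ∧ (∀ a, (Q a).PosSemidef) ∧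
      (∀ a, X a = P a - Q a) ∧ ∑ a, P a + ∑ a, Q a = 1 := by
  classical
  obtain ⟨a₀⟩ := ‹Nonempty α›
  -- The functional `F` below is positive on the part of the cone inside `W`. On `W` the sum `H (inl
  -- a) + H (inr a)` does not depend on `a`, so half of it serves as a single `L` dominating all the
  -- half-differences `± b a`.
  let W : Submodule ℝ (α ⊕ α → Matrix n n ℂ) :=
    { carrier := {H | ∀ a, H (.inl a) + H (.inr a) = H (.inl a₀) + H (.inr a₀)}
      add_mem' := fun {H K} hH hK a => by
        have := congrArg₂ (· + ·) (hH a) (hK a)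
        simp only [Pi.add_apply] at this ⊢
        rw [add_add_add_comm, this, add_add_add_comm]
      zero_mem' := fun a => by simp
      smul_mem' := fun c H hH a => by
        simp only [Pi.smul_apply, ← smul_add]
        rw [hH a] }
  let F : (α ⊕ α → Matrix n n ℂ) →ₗ[ℝ] ℝ :=
    { toFun := fun H => (1 / 2) * ((H (.inl a₀) + H (.inr a₀)).trace.re +
        ∑ a, ((H (.inl a) - H (.inr a)) * X a).trace.re)
      map_add' := fun H K => by
        have e (a : α) : ((H + K) (.inl a) - (H + K) (.inr a)) * X a =
            (H (.inl a) - H (.inr a)) * X a + (K (.inl a) - K (.inr a)) * X a := by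
          rw [← Matrix.add_mul]; congr 1; simp only [Pi.add_apply]; abel
        simp only [e]
        simp only [Matrix.trace_add, Complex.add_re, Finset.sum_add_distrib, Pi.add_apply]
        ring
      map_smul' := fun c H => by
        simp only [Pi.smul_apply, ← smul_sub, ← smul_add, Matrix.smul_mul, Matrix.trace_smul,
          Complex.smul_re, ← Finset.mul_sum, smul_eq_mul, RingHom.id_apply]
        ring }
  obtain ⟨g, hgf, hgpos⟩ := riesz_extension (accretiveCone (α ⊕ α) n)
    (⟨W, F.comp W.subtype⟩ : (α ⊕ α → Matrix n n ℂ) →ₗ.[ℝ] ℝ) (by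
      rintro ⟨H, hW⟩ hH
      replace hW : ∀ a, H (.inl a) + H (.inr a) = H (.inl a₀) + H (.inr a₀) := hW
      replace hH : ∀ i v, 0 ≤ (star v ⬝ᵥ H i *ᵥ v).re := hH
      change 0 ≤ F H
      have hp (i : α ⊕ α) := posSemidef_half_add_conjTranspose (hH i)
      -- Since each `X a` is Hermitian, the real traces in `F` see only the Hermitian parts `R`,
      -- which are positive semidefinite.
      set R : α ⊕ α → Matrix n n ℂ := fun i => (1 / 2 : ℂ) • (H i + (H i)ᴴ) with hR
      have hhalf : (0 : ℂ) ≤ 1 / 2 := by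
        rw [Complex.le_def]; norm_num
      have hsum (a : α) : R (.inl a) + R (.inr a) = R (.inl a₀) + R (.inr a₀) := by
        have e (a : α) : R (.inl a) + R (.inr a) =
            (1 / 2 : ℂ) • ((H (.inl a) + H (.inr a)) + (H (.inl a) + H (.inr a))ᴴ) := by
          simp only [hR, Matrix.conjTranspose_add, ← smul_add]; congr 1; abel
        rw [e, e, hW a]
      have key := trace_add_sum_trace_nonneg hX (L := (1 / 2 : ℂ) • (R (.inl a₀) + R (.inr a₀)))
        (b := fun a => (1 / 2 : ℂ) • (R (.inl a) - R (.inr a)))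
        (((hp _).add (hp _)).smul hhalf)
        (fun a => by
          have := (hp (.inl a)).isHermitian.sub (hp (.inr a)).isHermitian
          rw [Matrix.IsHermitian, Matrix.conjTranspose_smul, this.eq]
          simp [hR])
        (fun a => by
          convert hp (.inl a) using 1
          rw [← hsum a]; module)
        (fun a => by
          convert hp (.inr a) using 1
          rw [← hsum a]; module)
      have htr (Y : Matrix n n ℂ) : (Yᴴ).trace.re = Y.trace.re := by
        rw [Matrix.trace_conjTranspose]; simp
      have htr' (Y : Matrix n n ℂ) (a : α) : (Yᴴ * X a).trace.re = (Y * X a).trace.re := by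
        rw [← htr, Matrix.conjTranspose_mul, (hXH a).eq, Matrix.conjTranspose_conjTranspose,
          Matrix.trace_mul_comm]
      have hhre (z : ℂ) : ((1 / 2 : ℂ) * z).re = 1 / 2 * z.re := by
        simp
      simp only [hR, Matrix.trace_smul, Matrix.trace_add, Matrix.smul_mul, Matrix.sub_mul,
        Matrix.add_mul, Matrix.trace_sub, smul_eq_mul, Complex.add_re, Complex.sub_re, hhre,
        htr, htr'] at key
      change 0 ≤ (1 / 2) * ((H (.inl a₀) + H (.inr a₀)).trace.re +
        ∑ a, ((H (.inl a) - H (.inr a)) * X a).trace.re)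
      simp only [Matrix.trace_add, Matrix.sub_mul, Matrix.trace_sub, Complex.add_re,
        Complex.sub_re, mul_add, Finset.mul_sum]
      convert key using 1
      congr 1
      · ring
      · exact Finset.sum_congr rfl fun a _ => by ring) (by
      intro Y
      choose t ht using fun i => exists_smul_one_add_accretive (Y i)
      obtain ⟨s, hs⟩ := (Set.finite_range t).bddAbove
      refine ⟨⟨fun _ => (s : ℂ) • 1, fun a => rfl⟩, fun i v => ?_⟩
      exact ht i s (hs ⟨i, rfl⟩) v)
  have hrep (i : α ⊕ α) := exists_posSemidef_trace_eq
    (g.comp (LinearMap.single ℝ (fun _ : α ⊕ α => Matrix n n ℂ) i)) (fun Y hY => by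
      refine hgpos _ fun j v => ?_
      by_cases hij : j = i
      · subst hij; simpa using hY v
      · simp [hij])
  choose G hG hGeq using hrep
  have hgG (H : α ⊕ α → Matrix n n ℂ) : g H = ∑ i, (G i * H i).trace.re := by
    simp only [← hGeq]
    conv_lhs => rw [← Finset.univ_sum_single H]
    rw [map_sum]
    rfl
  refine ⟨fun a => G (.inl a), fun a => G (.inr a), fun a => hG _, fun a => hG _, fun a => ?_, ?_⟩
  · refine eq_of_forall_re_trace_mul_eq fun Y => ?_
    -- All the sums defining `W` vanish here, and `F H = Re tr (X a Y)`, so testing on this family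
    -- identifies `G (inl a) - G (inr a)` with `X a`.
    let H : α ⊕ α → Matrix n n ℂ := Sum.elim (Pi.single a Y) (Pi.single a (-Y))
    have hH : H ∈ W := fun b => by
      have e (b : α) : H (.inl b) + H (.inr b) = 0 := by
        by_cases hb : b = a
        · subst hb; simp [H]
        · simp [H, hb]
      rw [e, e]
    have h := hgf ⟨H, hH⟩
    change g H = (1 / 2) * ((H (.inl a₀) + H (.inr a₀)).trace.re +
        ∑ a, ((H (.inl a) - H (.inr a)) * X a).trace.re) at h
    have hs (b : α) : ((H (.inl b) - H (.inr b)) * X b).trace.re =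
        if b = a then 2 * (X a * Y).trace.re else 0 := by
      split_ifs with hb
      · subst hb
        have : H (.inl b) - H (.inr b) = (2 : ℝ) • Y := by simp [H, two_smul]
        rw [this, Matrix.smul_mul, Matrix.trace_smul, Complex.smul_re, smul_eq_mul,
          Matrix.trace_mul_comm]
      · simp [H, hb]
    have hg (b : α) : (G (.inl b) * H (.inl b)).trace.re + (G (.inr b) * H (.inr b)).trace.re =
        if b = a then ((G (.inl a) - G (.inr a)) * Y).trace.re else 0 := by
      split_ifs with hb
      · subst hb
        rw [Matrix.sub_mul]
        simp [H, sub_eq_add_neg]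
      · simp [H, hb]
    have h0 : H (.inl a₀) + H (.inr a₀) = 0 := by
      by_cases hb : a₀ = a
      · subst hb; simp [H]
      · simp [H, hb]
    rw [hgG, Fintype.sum_sum_type, ← Finset.sum_add_distrib, h0] at h
    simp only [hs, hg, Finset.sum_ite_eq', Finset.mem_univ, if_true, Matrix.trace_zero,
      Complex.zero_re, zero_add] at h
    rw [h]; ring
  · refine eq_of_forall_re_trace_mul_eq fun Y => ?_
    -- On constant families `F` is `Re tr Y`, which forces the densities to sum to `1`.
    have h := hgf ⟨fun _ => Y, fun b => rfl⟩
    change g (fun _ => Y) = (1 / 2) * ((Y + Y).trace.re + ∑ a, ((Y - Y) * X a).trace.re) at h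
    simp [hgG, Matrix.trace_add] at h
    simp [Matrix.add_mul, Finset.sum_mul, Matrix.trace_sum, Matrix.trace_add, h]
    ring

theorem exists_hermitianPart_decomposition {X : α → Matrix n n ℂ}
    (hX : ∀ B : α → Matrix n n ℂ, (∀ a, ‖B a‖ ≤ 1) → ‖∑ a, B a ⊗ₖ X a‖ ≤ 1) :
    ∃ P Q : α → Matrix n n ℂ, (∀ a, (P a).PosSemidef) ∧ (∀ a, (Q a).PosSemidef) ∧
      (∀ a, (1 / 2 : ℂ) • (X a + (X a)ᴴ) = P a - Q a) ∧
      (1 - ∑ a, P a).PosSemidef ∧ (1 - ∑ a, Q a).PosSemidef := by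
  -- For empty `α` the sums vanish and cannot add up to `1`, although the inequalities still hold.
  rcases isEmpty_or_nonempty α with hα | hα
  · exact ⟨isEmptyElim, isEmptyElim, isEmptyElim, isEmptyElim, isEmptyElim,
      by simpa using Matrix.PosSemidef.one, by simpa using Matrix.PosSemidef.one⟩
  obtain ⟨P, Q, hP, hQ, hPQ, hsum⟩ := exists_posSemidef_sub_of_isHermitian
    (X := fun a => (1 / 2 : ℂ) • (X a + (X a)ᴴ))
    (fun a => by
      simp [Matrix.IsHermitian, Matrix.conjTranspose_smul, Matrix.conjTranspose_add, add_comm])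
    (fun B hB hB1 => by
      -- For Hermitian `B a`, tensoring commutes with taking Hermitian parts, and the Hermitian part
      -- of a contraction is a contraction.
      have e : ∑ a, B a ⊗ₖ ((1 / 2 : ℂ) • (X a + (X a)ᴴ)) =
          (1 / 2 : ℂ) • ((∑ a, B a ⊗ₖ X a) + (∑ a, B a ⊗ₖ X a)ᴴ) := by
        rw [Matrix.conjTranspose_sum, ← Finset.sum_add_distrib, Finset.smul_sum]
        refine Finset.sum_congr rfl fun a _ => ?_
        rw [Matrix.kronecker_smul, Matrix.kronecker_add, Matrix.conjTranspose_kronecker,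
          (hB a).eq]
      have h := hX B hB1
      rw [e, norm_smul]
      have h2 := norm_add_le (∑ a, B a ⊗ₖ X a) (∑ a, B a ⊗ₖ X a)ᴴ
      rw [Matrix.l2_opNorm_conjTranspose] at h2
      have h3 : ‖(1 / 2 : ℂ)‖ = 1 / 2 := by simp
      rw [h3]
      linarith)
  refine ⟨P, Q, hP, hQ, hPQ, ?_, ?_⟩
  · rw [← hsum, add_sub_cancel_left]
    exact Matrix.posSemidef_sum _ fun a _ => hQ a
  · rw [← hsum, add_sub_cancel_right]
    exact Matrix.posSemidef_sum _ fun a _ => hP a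

/-- The Hermitian parts of `X` and `-iX` are the real and imaginary parts of `X`; splitting each
gives coefficients `1, i, -1, -i`. -/
theorem exists_posSemidef_decomposition {X : α → Matrix n n ℂ}
    (hX : ∀ B : α → Matrix n n ℂ, (∀ a, ‖B a‖ ≤ 1) → ‖∑ a, B a ⊗ₖ X a‖ ≤ 1) :
    ∃ E : Fin 4 → α → Matrix n n ℂ, (∀ r a, (E r a).PosSemidef) ∧
      (∀ r, (1 - ∑ a, E r a).PosSemidef) ∧
      ∀ a, X a = ∑ r : Fin 4, Complex.I ^ (r : ℕ) • E r a := by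
  obtain ⟨P, Q, hP, hQ, hPQ, hP1, hQ1⟩ := exists_hermitianPart_decomposition hX
  obtain ⟨P', Q', hP', hQ', hPQ', hP1', hQ1'⟩ := exists_hermitianPart_decomposition
    (X := fun a => -Complex.I • X a) (fun B hB => by
      simp only [Matrix.kronecker_smul, ← Finset.smul_sum, norm_smul]
      simpa using hX B hB)
  refine ⟨![P, P', Q, Q'], fun r a => ?_, fun r => ?_, fun a => ?_⟩
  · fin_cases r
    exacts [hP a, hP' a, hQ a, hQ' a]
  · fin_cases r
    exacts [hP1, hP1', hQ1, hQ1']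
  · have h1 := hPQ a
    have h2 := hPQ' a
    have e : X a = (1 / 2 : ℂ) • (X a + (X a)ᴴ) +
        Complex.I • ((1 / 2 : ℂ) • (-Complex.I • X a + (-Complex.I • X a)ᴴ)) := by
      ext i j
      simp
      linear_combination (1 / 2 * X a i j - 1 / 2 * (starRingEnd ℂ) (X a j i)) * Complex.I_sq
    rw [h1, h2] at e
    rw [e]
    simp [Fin.sum_univ_four, pow_succ, smul_sub]
    abel

end Decomposition

/-! ### Unit balls of the operator spaces -/

section OperatorSpace

variable {ι : Type} [Fintype ι] [DecidableEq ι]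

theorem enorm_le_one_iff {V : Type} [SeminormedAddCommGroup V] (v : V) : ‖v‖ₑ ≤ 1 ↔ ‖v‖ ≤ 1 := by
  rw [← ofReal_norm, ENNReal.ofReal_le_one]

theorem linftyNorms_le_one_iff {N : ℕ} (X : Matrix ι ι (Fin N → ℂ)) :
    linftyNorms N ι X ≤ 1 ↔ ∀ i, ‖X.map fun v => v i‖ ≤ 1 := by
  simp only [linftyNorms, scalarNorms, iSup_le_iff, enorm_le_one_iff]

theorem loneNorms_le_one_iff {M : ℕ} (X : Matrix ι ι (Fin M → ℂ)) :
    loneNorms M ι X ≤ 1 ↔ ∀ (k : ℕ) (B : Fin M → Matrix (Fin k) (Fin k) ℂ), (∀ a, ‖B a‖ ≤ 1) →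
      ‖∑ a, B a ⊗ₖ X.map fun v => v a‖ ≤ 1 := by
  simp only [loneNorms, cbNorm, iSup_le_iff, linftyNorms_le_one_iff, matrixSpaceNorms, scalarNorms,
    enorm_le_one_iff]
  have e (k : ℕ) (B : Matrix (Fin k) (Fin k) (Fin M → ℂ)) :
      Matrix.comp (Fin k) (Fin k) ι ι ℂ
        (B.map (Fintype.linearCombination ℂ fun a => X.map fun v => v a)) =
      ∑ a, (B.map fun v => v a) ⊗ₖ X.map fun v => v a := by
    ext ⟨i, i'⟩ ⟨j, j'⟩
    simp [Fintype.linearCombination_apply, Matrix.sum_apply, Matrix.comp_apply]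
  simp only [e]
  exact ⟨fun h k B hB => h k (Matrix.of fun i j a => B a i j) hB,
    fun h k B hB => h k (fun a => B.map fun v => v a) hB⟩

/-- The outer `ℓ_∞` norm is a maximum over `x` of the norms in `M_ι(ℓ_1^M)`. One direction tests on
the basis vector `e_x` of `ℓ_1^N`. Conversely, the contractions `∑ₐ Bₐ ⊗ X_{x,a}`, indexed by `x`,
are themselves admissible test matrices for an element of the unit ball of `M_k(ℓ_1^N)`. -/
theorem linftyLoneNorms_le_one_iff {N M : ℕ} (X : Matrix ι ι (Fin N → Fin M → ℂ)) :
    linftyLoneNorms N M ι X ≤ 1 ↔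
      ∀ x (k : ℕ) (B : Fin M → Matrix (Fin k) (Fin k) ℂ), (∀ a, ‖B a‖ ≤ 1) →
        ‖∑ a, B a ⊗ₖ X.map fun v => v x a‖ ≤ 1 := by
  simp only [linftyLoneNorms, cbNorm, iSup_le_iff, matrixSpaceNorms]
  constructor
  · intro h x k B hB
    have hC : loneNorms N (Fin 1)
        (Matrix.of fun _ _ => (Pi.single x 1 : Fin N → ℂ)) ≤ 1 := by
      rw [loneNorms_le_one_iff]
      intro l D hD
      rw [← norm_submatrix_equiv_le_one_iff _ (Equiv.prodUnique (Fin l) (Fin 1)).symm]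
      convert hD x using 2
      ext i j
      simp [Matrix.sum_apply, Pi.single_apply]
    have h1 := (loneNorms_le_one_iff _).1 (h 1 _ hC) k B hB
    rw [← norm_submatrix_equiv_le_one_iff _
      (Equiv.prodCongr (Equiv.refl (Fin k)) (Equiv.uniqueProd ι (Fin 1))).symm] at h1
    convert h1 using 2
    ext ⟨i, i'⟩ ⟨j, j'⟩
    simp [Matrix.sum_apply, Matrix.comp_apply, Fintype.linearCombination_apply]
    simp [Pi.single_apply]
  · intro h k C hC
    rw [loneNorms_le_one_iff] at hC ⊢
    intro l B hB
    let e := Fintype.equivFin (Fin l × ι)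
    have h1 := hC (Fintype.card (Fin l × ι))
      (fun x => (∑ a, B a ⊗ₖ X.map fun v => v x a).submatrix e.symm e.symm)
      (fun x => (norm_submatrix_equiv_le_one_iff _ _).2 (h x l B hB))
    -- Permutes the tensor factors so that the factors `l` and `ι` form one test matrix, in front of
    -- the factor `k` carrying `C`.
    let f : Fin l × (Fin k × ι) ≃ Fin (Fintype.card (Fin l × ι)) × Fin k :=
      { toFun := fun p => (e (p.1, p.2.2), p.2.1)
        invFun := fun q => ((e.symm q.1).1, (q.2, (e.symm q.1).2))
        left_inv := fun p => by simp
        right_inv := fun q => by simp }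
    rw [← norm_submatrix_equiv_le_one_iff _ f] at h1
    convert h1 using 2
    ext ⟨i, i', i''⟩ ⟨j, j', j''⟩
    simp [Matrix.sum_apply, Matrix.comp_apply, f, Fintype.linearCombination_apply, Finset.mul_sum,
      Finset.sum_mul]
    rw [Finset.sum_comm]
    refine Finset.sum_congr rfl fun x _ => Finset.sum_congr rfl fun a _ => ?_
    ring

theorem linftyLoneNorms_assemble_le_one_iff {N M n : ℕ}
    {E : Fin N → Fin M → Matrix (Fin n) (Fin n) ℂ} (hE : ∀ x a, (E x a).PosSemidef) :
    linftyLoneNorms N M (Fin n) (assemble E) ≤ 1 ↔ IsIncompletePOVM E := by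
  rw [linftyLoneNorms_le_one_iff]
  have hmap (x : Fin N) (a : Fin M) : ((assemble E).map fun v => v x a) = E x a := rfl
  simp only [hmap]
  constructor
  · refine fun h => ⟨hE, fun x => ?_⟩
    rw [← norm_le_one_iff_of_posSemidef (Matrix.posSemidef_sum _ fun a _ => hE x a)]
    have h1 := h x 1 (fun _ => 1) (fun a => by
      rw [norm_le_one_iff_posSemidef]; simpa using Matrix.PosSemidef.zero)
    rw [← norm_submatrix_equiv_le_one_iff _ (Equiv.uniqueProd (Fin n) (Fin 1)).symm] at h1
    convert h1 using 2
    ext i j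
    simp [Matrix.sum_apply]
  · exact fun h x k B hB => norm_sum_kronecker_posSemidef_le_one (hE x) (h.2 x) hB

end OperatorSpace

/-! ### The bilinear form -/

section Bilinear

variable {𝕜 : Type} [RCLike 𝕜] {N M : ℕ} (T : BellArray N M)

/-- The bilinear form of a Bell functional, bundled. -/
def bellBilin (𝕜 : Type) [RCLike 𝕜] {N M : ℕ} (T : BellArray N M) :
    (Fin N → Fin M → 𝕜) →ₗ[𝕜] (Fin N → Fin M → 𝕜) →ₗ[𝕜] 𝕜 :=
  LinearMap.mk₂ 𝕜 (bellForm 𝕜 T)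
    (fun u u' v => by simp [bellForm, mul_add, add_mul, Finset.sum_add_distrib])
    (fun c u v => by
      simp only [bellForm, Finset.mul_sum, Pi.smul_apply, smul_eq_mul]
      refine Finset.sum_congr rfl fun _ _ => Finset.sum_congr rfl fun _ _ =>
        Finset.sum_congr rfl fun _ _ => Finset.sum_congr rfl fun _ _ => by ring)
    (fun u v v' => by simp [bellForm, mul_add, Finset.sum_add_distrib])
    (fun c u v => by
      simp only [bellForm, Finset.mul_sum, Pi.smul_apply, smul_eq_mul]
      refine Finset.sum_congr rfl fun _ _ => Finset.sum_congr rfl fun _ _ =>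
        Finset.sum_congr rfl fun _ _ => Finset.sum_congr rfl fun _ _ => by ring)

theorem bellBilin_apply (u v : Fin N → Fin M → 𝕜) : bellBilin 𝕜 T u v = bellForm 𝕜 T u v := rfl

end Bilinear

/-! ### Local distributions -/

section Classical

variable {N M : ℕ} (T : BellArray N M)

theorem enorm_bellForm_le_realNorm {q q' : Fin N → Fin M → ℝ} (hq : ∀ x, ∑ a, |q x a| ≤ 1)
    (hq' : ∀ x, ∑ a, |q' x a| ≤ 1) : ‖bellForm ℝ T q q'‖ₑ ≤ realNorm T := by
  have h {q : Fin N → Fin M → ℝ} (hq : ∀ x, ∑ a, |q x a| ≤ 1) :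
      ‖fun x => (WithLp.toLp 1 (q x) : PiLp 1 fun _ : Fin M => ℝ)‖ ≤ 1 := by
    rw [pi_norm_le_iff_of_nonneg zero_le_one]
    intro x
    rw [PiLp.norm_eq_of_L1]
    exact hq x
  exact le_iSup₂_of_le (fun x => WithLp.toLp 1 (q x)) (fun x => WithLp.toLp 1 (q' x))
    (le_iSup₂_of_le (h hq) (h hq') le_rfl)

theorem realNorm_le {c : ℝ≥0∞} (h : ∀ u v : Fin N → Fin M → ℝ, (∀ x, ∑ a, |u x a| ≤ 1) →
    (∀ x, ∑ a, |v x a| ≤ 1) → ‖bellForm ℝ T u v‖ₑ ≤ c) : realNorm T ≤ c := by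
  have h1 {u : Fin N → PiLp 1 fun _ : Fin M => ℝ} (hu : ‖u‖ ≤ 1) (x : Fin N) :
      ∑ a, |u x a| ≤ 1 := by
    have := (pi_norm_le_iff_of_nonneg zero_le_one).1 hu x
    rwa [PiLp.norm_eq_of_L1] at this
  exact iSup₂_le fun u v => iSup₂_le fun hu hv => h _ _ (h1 hu) (h1 hv)

theorem realNorm_lt_top : realNorm T < ⊤ := by
  refine (realNorm_le T (c := ENNReal.ofReal (∑ x, ∑ y, ∑ a, ∑ b, |T x y a b|))
    fun u v hu hv => ?_).trans_lt ENNReal.ofReal_lt_top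
  rw [← ofReal_norm]
  refine ENNReal.ofReal_le_ofReal ?_
  have h1 {u : Fin N → Fin M → ℝ} (hu : ∀ x, ∑ a, |u x a| ≤ 1) (x a) : |u x a| ≤ 1 :=
    (Finset.single_le_sum (f := fun a => |u x a|) (fun _ _ => abs_nonneg _)
      (Finset.mem_univ a)).trans (hu x)
  refine (norm_sum_le _ _).trans (Finset.sum_le_sum fun x _ => ?_)
  refine (norm_sum_le _ _).trans (Finset.sum_le_sum fun y _ => ?_)
  refine (norm_sum_le _ _).trans (Finset.sum_le_sum fun a _ => ?_)
  refine (norm_sum_le _ _).trans (Finset.sum_le_sum fun b _ => ?_)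
  rw [Real.norm_eq_abs, abs_mul, abs_mul, mul_assoc]
  exact mul_le_of_le_one_right (abs_nonneg _)
    (mul_le_one₀ (h1 hu x a) (abs_nonneg _) (h1 hv y b))

theorem IsIncompleteDistribution.le_one {q : Fin N → Fin M → ℝ} (hq : IsIncompleteDistribution q)
    (x : Fin N) (a : Fin M) : q x a ≤ 1 :=
  (Finset.single_le_sum (f := fun a => q x a) (fun _ _ => hq.1 x _) (Finset.mem_univ a)).trans
    (hq.2 x)

theorem IsIncompleteDistribution.sum_abs_le_one {q : Fin N → Fin M → ℝ}
    (hq : IsIncompleteDistribution q) (x : Fin N) : ∑ a, |q x a| ≤ 1 := by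
  simpa only [abs_of_nonneg (hq.1 x _)] using hq.2 x

/-- `⟨T, P⟩` is the `μ`-average of values of the bilinear form on pairs from the unit ball. -/
theorem supValue_localIn_le_realNorm : supValue T (localIn N M) ≤ realNorm T := by
  refine iSup₂_le fun P hP => ?_
  obtain ⟨Λ, _, μ, q, q', hμ, hqm, hqm', hq, hq', hP⟩ := hP
  have hmeas {q : Λ → Fin N → Fin M → ℝ} (h : Measurable q) (x a) : Measurable fun l => q l x a :=
    measurable_pi_iff.1 (measurable_pi_iff.1 h x) a
  have hint (x y a b) : MeasureTheory.Integrable (fun l => q l x a * q' l y b) μ := by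
    refine .of_bound ((hmeas hqm x a).mul (hmeas hqm' y b)).aestronglyMeasurable 1
      (Filter.Eventually.of_forall fun l => ?_)
    rw [Real.norm_of_nonneg (mul_nonneg ((hq l).1 x a) ((hq' l).1 y b))]
    exact mul_le_one₀ ((hq l).le_one x a) ((hq' l).1 y b) ((hq' l).le_one y b)
  have hpair : pairing T P = ∫ l, bellForm ℝ T (q l) (q' l) ∂μ := by
    simp only [pairing, bellForm, hP]
    have hint' (x y a b) : MeasureTheory.Integrable
        (fun l => ((T x y a b : ℝ) : ℝ) * q l x a * q' l y b) μ := by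
      simpa only [mul_assoc] using (hint x y a b).const_mul (T x y a b)
    simp only [RCLike.ofReal_real_eq_id, id_eq]
    rw [MeasureTheory.integral_finsetSum _ fun x _ => MeasureTheory.integrable_finsetSum _
      fun y _ => MeasureTheory.integrable_finsetSum _ fun a _ =>
        MeasureTheory.integrable_finsetSum _ fun b _ => hint' x y a b]
    refine Finset.sum_congr rfl fun x _ => ?_
    rw [MeasureTheory.integral_finsetSum _ fun y _ => MeasureTheory.integrable_finsetSum _
      fun a _ => MeasureTheory.integrable_finsetSum _ fun b _ => hint' x y a b]
    refine Finset.sum_congr rfl fun y _ => ?_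
    rw [MeasureTheory.integral_finsetSum _ fun a _ => MeasureTheory.integrable_finsetSum _
      fun b _ => hint' x y a b]
    refine Finset.sum_congr rfl fun a _ => ?_
    rw [MeasureTheory.integral_finsetSum _ fun b _ => hint' x y a b]
    refine Finset.sum_congr rfl fun b _ => ?_
    simp only [mul_assoc, MeasureTheory.integral_const_mul]
  rw [hpair]
  refine (MeasureTheory.enorm_integral_le_lintegral_enorm _).trans ?_
  calc ∫⁻ l, ‖bellForm ℝ T (q l) (q' l)‖ₑ ∂μ ≤ ∫⁻ _, realNorm T ∂μ :=
        MeasureTheory.lintegral_mono fun l =>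
          enorm_bellForm_le_realNorm T (hq l).sum_abs_le_one (hq' l).sum_abs_le_one
    _ = realNorm T := by simp

theorem enorm_bellForm_le_supValue {q q' : Fin N → Fin M → ℝ} (hq : IsIncompleteDistribution q)
    (hq' : IsIncompleteDistribution q') : ‖bellForm ℝ T q q'‖ₑ ≤ supValue T (localIn N M) := by
  -- A product distribution needs only a one-point hidden variable.
  have hmem : (fun x y a b => q x a * q' y b) ∈ localIn N M :=
    ⟨Unit, inferInstance, MeasureTheory.Measure.dirac (), fun _ => q, fun _ => q', inferInstance,
      measurable_const, measurable_const, fun _ => hq, fun _ => hq', fun x y a b => by simp⟩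
  refine le_iSup₂_of_le _ hmem (le_of_eq ?_)
  simp [pairing, bellForm, mul_assoc]

theorem isIncompleteDistribution_posPart {u : Fin N → Fin M → ℝ} (hu : ∀ x, ∑ a, |u x a| ≤ 1) :
    IsIncompleteDistribution fun x a => max (u x a) 0 :=
  ⟨fun _ _ => le_max_right _ _, fun x =>
    (Finset.sum_le_sum fun _ _ => max_le (le_abs_self _) (abs_nonneg _)).trans (hu x)⟩

theorem realNorm_le_four_mul_supValue : realNorm T ≤ 4 * supValue T (localIn N M) := by
  refine realNorm_le T fun u v hu hv => ?_
  have hsplit (u : Fin N → Fin M → ℝ) :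
      u = (fun x a => max (u x a) 0) - fun x a => max ((-u) x a) 0 := by
    ext x a
    rcases le_total (u x a) 0 with h | h <;> simp [h]
  have hneg {u : Fin N → Fin M → ℝ} (hu : ∀ x, ∑ a, |u x a| ≤ 1) (x : Fin N) :
      ∑ a, |(-u) x a| ≤ 1 := by simpa using hu x
  have hpu := isIncompleteDistribution_posPart hu
  have hnu := isIncompleteDistribution_posPart (hneg hu)
  have hpv := isIncompleteDistribution_posPart hv
  have hnv := isIncompleteDistribution_posPart (hneg hv)
  rw [← bellBilin_apply]
  nth_rw 1 [hsplit u, hsplit v]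
  rw [map_sub, map_sub, LinearMap.sub_apply, LinearMap.sub_apply]
  simp only [bellBilin_apply]
  refine (enorm_sub_le).trans ?_
  refine (add_le_add enorm_sub_le enorm_sub_le).trans ?_
  refine (add_le_add (add_le_add (enorm_bellForm_le_supValue T hpu hpv)
    (enorm_bellForm_le_supValue T hnu hpv)) (add_le_add (enorm_bellForm_le_supValue T hpu hnv)
    (enorm_bellForm_le_supValue T hnu hnv))).trans (le_of_eq ?_)
  ring

theorem supValue_localIn_pos (hT : T ≠ 0) : 0 < supValue T (localIn N M) := by
  obtain ⟨x, y, a, b, h⟩ : ∃ x y a b, T x y a b ≠ 0 := by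
    by_contra! h
    exact hT (by ext x y a b; exact h x y a b)
  -- Incompleteness allows all mass to vanish off a single input, so a product of two such families
  -- isolates one coefficient of `T`.
  have hdist (x : Fin N) (a : Fin M) :
      IsIncompleteDistribution (Pi.single x (Pi.single a 1) : Fin N → Fin M → ℝ) := by
    refine ⟨fun x' a' => ?_, fun x' => ?_⟩ <;> by_cases hx : x' = x
    · subst hx
      by_cases ha : a' = a
      · subst ha; simp
      · simp [ha]
    · simp [hx]
    · subst hx; simp
    · simp [hx]
  refine lt_of_lt_of_le ?_ (enorm_bellForm_le_supValue T (hdist x a) (hdist y b))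
  have e : bellForm ℝ T (Pi.single x (Pi.single a 1)) (Pi.single y (Pi.single b 1)) =
      T x y a b := by
    unfold bellForm
    rw [Finset.sum_eq_single x (fun x' _ hx => by simp [hx]) (by simp),
      Finset.sum_eq_single y (fun y' _ hy => by simp [hy]) (by simp),
      Finset.sum_eq_single a (fun a' _ ha => by simp [ha]) (by simp),
      Finset.sum_eq_single b (fun b' _ hb => by simp [hb]) (by simp)]
    simp
  rw [e]
  exact enorm_pos.2 h

end Classical

/-! ### Quantum distributions -/

section Quantum

variable {N M n : ℕ} (T : BellArray N M)

theorem amplification_eq_sum_kronecker (X Y : Matrix (Fin n) (Fin n) (Fin N → Fin M → ℂ)) :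
    amplification n T X Y = ∑ x, ∑ y, ∑ a, ∑ b,
      (T x y a b : ℂ) • ((X.map fun v => v x a) ⊗ₖ Y.map fun v => v y b) := by
  ext ⟨i, i'⟩ ⟨j, j'⟩
  simp [amplification, bellForm, Matrix.sum_apply, mul_assoc]

theorem isHermitian_amplification_assemble {E F : Fin N → Fin M → Matrix (Fin n) (Fin n) ℂ}
    (hE : ∀ x a, (E x a).IsHermitian) (hF : ∀ x a, (F x a).IsHermitian) :
    (amplification n T (assemble E) (assemble F)).IsHermitian := by
  have hmap (E : Fin N → Fin M → Matrix (Fin n) (Fin n) ℂ) (x : Fin N) (a : Fin M) :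
    ((assemble E).map fun v => v x a) = E x a := rfl
  rw [Matrix.IsHermitian, amplification_eq_sum_kronecker]
  simp only [Matrix.conjTranspose_sum, Matrix.conjTranspose_smul, Matrix.conjTranspose_kronecker,
    hmap, (hE _ _).eq, (hF _ _).eq, RCLike.star_def, Complex.conj_ofReal]

theorem trace_mul_amplification_assemble (E F : Fin N → Fin M → Matrix (Fin n) (Fin n) ℂ)
    (ρ : Matrix (Fin n × Fin n) (Fin n × Fin n) ℂ) {P : BellArray N M}
    (hP : ∀ x y a b, (P x y a b : ℂ) = (ρ * (E x a ⊗ₖ F y b)).trace) :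
    (ρ * amplification n T (assemble E) (assemble F)).trace = pairing T P := by
  have hmap (E : Fin N → Fin M → Matrix (Fin n) (Fin n) ℂ) (x : Fin N) (a : Fin M) :
    ((assemble E).map fun v => v x a) = E x a := rfl
  rw [amplification_eq_sum_kronecker]
  simp only [Matrix.mul_sum, Matrix.trace_sum, Matrix.mul_smul, Matrix.trace_smul, hmap, ← hP,
    pairing, smul_eq_mul]
  push_cast
  rfl

theorem enorm_amplification_le_amplificationNorm
    {X Y : Matrix (Fin n) (Fin n) (Fin N → Fin M → ℂ)} (hX : linftyLoneNorms N M (Fin n) X ≤ 1)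
    (hY : linftyLoneNorms N M (Fin n) Y ≤ 1) :
    ‖amplification n T X Y‖ₑ ≤ amplificationNorm n T :=
  le_iSup₂_of_le X Y (le_iSup₂_of_le hX hY le_rfl)

theorem supValue_quantumIn_le_amplificationNorm :
    supValue T (quantumIn N M n) ≤ amplificationNorm n T := by
  refine iSup₂_le fun P hP => ?_
  obtain ⟨E, F, ρ, hE, hF, hρ, htr, hP⟩ := hP
  refine le_trans ?_ (enorm_amplification_le_amplificationNorm T
    ((linftyLoneNorms_assemble_le_one_iff hE.1).2 hE)
    ((linftyLoneNorms_assemble_le_one_iff hF.1).2 hF))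
  have h := abs_trace_mul_le hρ htr (isHermitian_amplification_assemble T
    (fun x a => (hE.1 x a).isHermitian) (fun x a => (hF.1 x a).isHermitian))
  rw [trace_mul_amplification_assemble T E F ρ hP, Complex.ofReal_re] at h
  rw [← ofReal_norm, ← ofReal_norm]
  exact ENNReal.ofReal_le_ofReal h

/-- The amplified matrix is Hermitian, so its norm is attained through states, and its trace against
a state is the value of `T` on a quantum distribution. -/
theorem enorm_amplification_assemble_le_supValue
    {E F : Fin N → Fin M → Matrix (Fin n) (Fin n) ℂ} (hE : IsIncompletePOVM E)
    (hF : IsIncompletePOVM F) :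
    ‖amplification n T (assemble E) (assemble F)‖ₑ ≤ supValue T (quantumIn N M n) := by
  by_cases htop : supValue T (quantumIn N M n) = ⊤
  · rw [htop]; exact le_top
  rw [← ofReal_norm, ← ENNReal.ofReal_toReal htop]
  refine ENNReal.ofReal_le_ofReal (norm_le_of_abs_trace_mul_le
    (isHermitian_amplification_assemble T (fun x a => (hE.1 x a).isHermitian)
      (fun x a => (hF.1 x a).isHermitian)) ENNReal.toReal_nonneg fun ρ hρ htr => ?_)
  let P : BellArray N M := fun x y a b => (ρ * (E x a ⊗ₖ F y b)).trace.re
  have hP (x y a b) : (P x y a b : ℂ) = (ρ * (E x a ⊗ₖ F y b)).trace :=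
    Complex.ext rfl (Complex.le_def.1
      (trace_mul_nonneg hρ ((hE.1 x a).kronecker (hF.1 y b)))).2
  rw [trace_mul_amplification_assemble T E F ρ hP, Complex.ofReal_re]
  have h : ‖pairing T P‖ₑ ≤ supValue T (quantumIn N M n) :=
    le_iSup₂_of_le P ⟨E, F, ρ, hE, hF, hρ, htr, hP⟩ le_rfl
  have h' := ENNReal.toReal_mono htop h
  rwa [toReal_enorm] at h'

theorem exists_incompletePOVM_decomposition {X : Matrix (Fin n) (Fin n) (Fin N → Fin M → ℂ)}
    (hX : linftyLoneNorms N M (Fin n) X ≤ 1) :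
    ∃ E : Fin 4 → Fin N → Fin M → Matrix (Fin n) (Fin n) ℂ, (∀ r, IsIncompletePOVM (E r)) ∧
      ∀ i j, X i j = ∑ r : Fin 4, Complex.I ^ (r : ℕ) • assemble (E r) i j := by
  rw [linftyLoneNorms_le_one_iff] at hX
  choose E hE hE1 hXE using fun x => exists_posSemidef_decomposition
    -- Test matrices of size `n` suffice, as in Smith's lemma for maps into `M_n`.
    (X := fun a => X.map fun v => v x a) fun B hB => hX x n B hB
  refine ⟨fun r x a => E x r a, fun r => ⟨fun x a => hE x r a, fun x => hE1 x r⟩, fun i j => ?_⟩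
  ext x a
  have h := congrFun (congrFun (hXE x a) i) j
  simpa [assemble, Matrix.sum_apply, Finset.sum_apply] using h

theorem amplificationNorm_le_sixteen_mul_supValue :
    amplificationNorm n T ≤ 16 * supValue T (quantumIn N M n) := by
  refine iSup₂_le fun X Y => iSup₂_le fun hX hY => ?_
  obtain ⟨E, hE, hXE⟩ := exists_incompletePOVM_decomposition hX
  obtain ⟨F, hF, hYF⟩ := exists_incompletePOVM_decomposition hY
  -- Sixteen terms with unimodular coefficients, each bounded by the quantum value.
  have e : amplification n T X Y = ∑ r : Fin 4, ∑ s : Fin 4,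
      (Complex.I ^ (r : ℕ) * Complex.I ^ (s : ℕ)) •
        amplification n T (assemble (E r)) (assemble (F s)) := by
    ext ⟨i, i'⟩ ⟨j, j'⟩
    simp only [amplification, Matrix.kroneckerMap_apply, Matrix.sum_apply, Matrix.smul_apply,
      ← bellBilin_apply, hXE i j, hYF i' j', map_sum, map_smul, LinearMap.sum_apply,
      LinearMap.smul_apply, Finset.smul_sum, smul_smul]
    rw [Finset.sum_comm]
    refine Finset.sum_congr rfl fun r _ => Finset.sum_congr rfl fun s _ => ?_
    rw [mul_comm]
  rw [e]
  refine (enorm_sum_le _ _).trans ((Finset.sum_le_sum fun r _ => (enorm_sum_le _ _).trans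
    (Finset.sum_le_sum fun s _ => ?_)).trans_eq (b := ∑ r : Fin 4, ∑ s : Fin 4,
      supValue T (quantumIn N M n)) ?_)
  · rw [enorm_smul]
    have h1 : ‖Complex.I ^ (r : ℕ) * Complex.I ^ (s : ℕ)‖ₑ = 1 := by
      rw [← ofReal_norm]; simp
    rw [h1, one_mul]
    exact enorm_amplification_assemble_le_supValue T (hE r) (hF s)
  · simp only [Finset.sum_const, Finset.card_univ, Fintype.card_fin, nsmul_eq_mul, ← mul_assoc]
    norm_num

theorem norm_map_le_one_of_linftyLoneNorms_le_one {X : Matrix (Fin n) (Fin n) (Fin N → Fin M → ℂ)}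
    (hX : linftyLoneNorms N M (Fin n) X ≤ 1) (x : Fin N) (a : Fin M) :
    ‖X.map fun v => v x a‖ ≤ 1 := by
  rw [linftyLoneNorms_le_one_iff] at hX
  -- The scalar test element `e_a` of `ℓ_∞^M` extracts one coefficient.
  have h := hX x 1 (Pi.single a 1) (fun b => by
    rw [norm_le_one_iff_posSemidef]
    by_cases hb : b = a
    · subst hb; simpa using Matrix.PosSemidef.zero
    · simpa [hb] using Matrix.PosSemidef.one)
  rw [← norm_submatrix_equiv_le_one_iff _ (Equiv.uniqueProd (Fin n) (Fin 1)).symm] at h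
  convert h using 2
  ext i j
  rw [Finset.sum_eq_single a (fun b _ hb => by simp [hb]) (by simp)]
  simp

theorem amplificationNorm_lt_top : amplificationNorm n T < ⊤ := by
  have hle : amplificationNorm n T ≤ ENNReal.ofReal (∑ x, ∑ y, ∑ a, ∑ b, |T x y a b|) := by
    refine iSup₂_le fun X Y => iSup₂_le fun hX hY => ?_
    rw [← ofReal_norm, amplification_eq_sum_kronecker]
    refine ENNReal.ofReal_le_ofReal ?_
    refine (norm_sum_le _ _).trans (Finset.sum_le_sum fun x _ => ?_)
    refine (norm_sum_le _ _).trans (Finset.sum_le_sum fun y _ => ?_)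
    refine (norm_sum_le _ _).trans (Finset.sum_le_sum fun a _ => ?_)
    refine (norm_sum_le _ _).trans (Finset.sum_le_sum fun b _ => ?_)
    rw [norm_smul, Complex.norm_real, Real.norm_eq_abs]
    exact mul_le_of_le_one_right (abs_nonneg _) (norm_kronecker_le_one
      (norm_map_le_one_of_linftyLoneNorms_le_one hX x a)
      (norm_map_le_one_of_linftyLoneNorms_le_one hY y b))
  exact hle.trans_lt ENNReal.ofReal_lt_top

end Quantum

/-! ### Comparison of the ratios -/

theorem div_comparison {t l A q : ℝ≥0∞} (hlt : l ≤ t) (htl : t ≤ 4 * l)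
    (hqA : q ≤ A) (hAq : A ≤ 16 * q) :
    1 / 16 * (A / t) ≤ q / l ∧ q / l ≤ 4 * (A / t) := by
  constructor
  · calc 1 / 16 * (A / t) ≤ 1 / 16 * (16 * q / l) := by gcongr
      _ = q / l := by
        rw [mul_div_assoc, ← mul_assoc, one_div, ENNReal.inv_mul_cancel (by simp) (by simp),
          one_mul]
  · have h4 : t / 4 ≤ l := ENNReal.div_le_of_le_mul' htl
    calc q / l ≤ A / (t / 4) := by gcongr
      _ = 4 * (A / t) := by
        rw [div_eq_mul_inv, div_eq_mul_inv t, ENNReal.mul_inv (by simp) (by simp), inv_inv,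
          div_eq_mul_inv]
        ring

end BellViolation

end

theorem mainTheorem2 (N M n : ℕ) (T : BellViolation.BellArray N M) :
    -- the real bilinear norm
    (BellViolation.realNorm T < ⊤ ∧
      BellViolation.supValue T (BellViolation.localIn N M) ≤ BellViolation.realNorm T ∧
      BellViolation.realNorm T ≤ 4 * BellViolation.supValue T (BellViolation.localIn N M)) ∧
    -- positive elements of the unit ball of `M_n(ℓ_∞^N(ℓ_1^M))` are the incomplete POVMs
    (∀ E : Fin N → Fin M → Matrix (Fin n) (Fin n) ℂ, (∀ x a, (E x a).PosSemidef) →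
      (BellViolation.linftyLoneNorms N M (Fin n) (BellViolation.assemble E) ≤ 1 ↔
        BellViolation.IsIncompletePOVM E)) ∧
    -- the norm of the amplification
    (BellViolation.amplificationNorm n T < ⊤ ∧
      BellViolation.supValue T (BellViolation.quantumIn N M n) ≤
        BellViolation.amplificationNorm n T ∧
      BellViolation.amplificationNorm n T ≤
        16 * BellViolation.supValue T (BellViolation.quantumIn N M n)) ∧
    -- the ratio
    (T ≠ 0 →
      0 < BellViolation.realNorm T ∧
      0 < BellViolation.supValue T (BellViolation.localIn N M) ∧
      1 / 16 * (BellViolation.amplificationNorm n T / BellViolation.realNorm T) ≤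
        BellViolation.supValue T (BellViolation.quantumIn N M n) /
          BellViolation.supValue T (BellViolation.localIn N M) ∧
      BellViolation.supValue T (BellViolation.quantumIn N M n) /
          BellViolation.supValue T (BellViolation.localIn N M) ≤
        4 * (BellViolation.amplificationNorm n T / BellViolation.realNorm T)) := by
  open BellViolation in
  exact ⟨⟨realNorm_lt_top T, supValue_localIn_le_realNorm T, realNorm_le_four_mul_supValue T⟩,
    fun E hE => linftyLoneNorms_assemble_le_one_iff hE,
    ⟨amplificationNorm_lt_top T, supValue_quantumIn_le_amplificationNorm T,
      amplificationNorm_le_sixteen_mul_supValue T⟩,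
    fun hT => ⟨(supValue_localIn_pos T hT).trans_le (supValue_localIn_le_realNorm T),
      supValue_localIn_pos T hT,
      div_comparison (supValue_localIn_le_realNorm T) (realNorm_le_four_mul_supValue T)
        (supValue_quantumIn_le_amplificationNorm T)
        (amplificationNorm_le_sixteen_mul_supValue T)⟩⟩
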